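/- Let $A\in\mathbb R^{k\times n}$ with $n\ge 1$, $y\in\mathbb R^k$, $\delta\ge 0$, $\lambda\ge 0$ and $\mu>0$. Write $\mathbf 1\in\mathbb R^n$ for the all-ones vector, $B(y,\delta)=\{z\in\mathbb R^k:\|z-y\|_2\le\delta\}$, and $\iota_S$ for the function that is $0$ on $S$ and $+\infty$ off $S$. Vector inequalities and maxima are componentwise. A minimizer of an extended-real-valued function is a point where the least value is attained and is finite. Consider the problems $$(\mathrm{CBPDN})\quad \min_{x}\ \|x\|_1\quad\text{subject to } \|Ax-y\|_2\le\delta,\ x\ge 0,\ \mathbf 1^Tx=1,$$ $$(\mathrm{CBP})\quad \min_{x}\ \|x\|_1\quad\text{subject to } Ax=y,\ x\ge 0,\ \mathbf 1^Tx=1.$$ Put $$f_1(x)=\iota_{\{1\}}(\mathbf 1^Tx),\qquad f_2(u)=\iota_{B(y,\delta)}(u_1)+\lambda\|u_2\|_1+\iota_{\mathbb R^n_+}(u_2)\quad (u=(u_1,u_2)\in\mathbb R^k\times\mathbb R^n),\qquad G=\begin{bmatrix}A\\ I\end{bmatrix},$$ $$M=A^TA+I,\qquad c=M^{-1}\mathbf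 1(\mathbf 1^TM^{-1}\mathbf 1)^{-1},$$ $$\psi(\nu)=\nu\ \text{ if }\|\nu-y\|_2\le\delta,\qquad \psi(\nu)=y+\delta\,\frac{\nu-y}{\|\nu-y\|_2}\ \text{ otherwise,}$$ and $\operatorname{soft}(\nu,\tau)_i=\operatorname{sign}(\nu_i)\max\{|\nu_i|-\tau,0\}$. Given arbitrary $u_{1,0},d_{1,0}\in\mathbb R^k$ and $u_{2,0},d_{2,0}\in\mathbb R^n$, C-SUnSAL computes, for $j=0,1,2,\dots$, $$\begin{aligned} w_j&=A^T(u_{1,j}+d_{1,j})+(u_{2,j}+d_{2,j}),\\ x_{j+1}&=M^{-1}w_j-c\,(\mathbf 1^TM^{-1}w_j-1),\\ u_{1,j+1}&=\psi(Ax_{j+1}-d_{1,j}),\\ u_{2,j+1}&=\max\{0,\operatorname{soft}(x_{j+1}-d_{2,j},\lambda/\mu)\},\\ d_{1,j+1}&=d_{1,j}-(Ax_{j+1}-u_{1,j+1}),\\ d_{2,j+1}&=d_{2,j}-(x_{j+1}-u_{2,j+1}). \end{aligned}$$ Then the following hold. 1. The solutions of CBPDN are exactly the minimizers of $f_1(x)+f_2(Gx)$,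 and the solutions of CBP are exactly those of CBPDN with $\delta=0$. If CBPDN is feasible, it has a solution. 2. $f_1$ and $f_2$ are closed, proper and convex, and $G$ has full column rank. 3. $M$ is invertible, $\mathbf 1^TM^{-1}\mathbf 1\ne 0$, and for all $u=(u_1,u_2)$, $d=(d_1,d_2)$ the unique minimizer of $x\mapsto f_1(x)+\frac\mu2\|Gx-u-d\|_2^2$ is $M^{-1}w-c(\mathbf 1^TM^{-1}w-1)$ with $w=A^T(u_1+d_1)+(u_2+d_2)$. 4. For every $\nu\in\mathbb R^k$, $\psi(\nu)$ is the unique minimizer of $\frac12\|u-\nu\|_2^2+\iota_{B(y,\delta)}(u)$. For every $\nu\in\mathbb R^n$, $\max\{0,\operatorname{soft}(\nu,\lambda/\mu)\}$ is the unique minimizer of $\frac12\|u-\nu\|_2^2+\frac\lambda\mu\|u\|_1+\iota_{\mathbb R^n_+}(u)$. For all $x$ and $d=(d_1,d_2)$, the unique minimizer of $u\mapsto f_2(u)+\frac\mu2\|Gx-u-d\|_2^2$ is $\bigl(\psi(Ax-d_1),\max\{0,\operatorname{soft}(x-d_2,\lambda/\mu)\}\bigr)$. 5. Sequences $x_j$,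 $u_j=(u_{1,j},u_{2,j})$, $d_j=(d_{1,j},d_{2,j})$ are generated by C-SUnSAL if and only if they satisfy the ADMM recursion for $f_1,f_2,G,\mu$: for all $j\ge 0$, $x_{j+1}$ minimizes $f_1(x)+\frac\mu2\|Gx-u_j-d_j\|_2^2$, $u_{j+1}$ minimizes $f_2(u)+\frac\mu2\|Gx_{j+1}-u-d_j\|_2^2$, and $d_{j+1}=d_j-(Gx_{j+1}-u_{j+1})$. 6. If CBPDN has a solution, then for every initialization the C-SUnSAL sequence $(x_j)$ converges to a solution of CBPDN. In particular, if $\delta=0$ and CBP has a solution, $(x_j)$ converges to a solution of CBP. -/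

import Mathlib

open Filter Topology Matrix

noncomputable section

/-! Vectors are plain functions `ι → ℝ`; since the norm instance on that type is the sup norm, the
`ℓ₁` and `ℓ₂` norms are written out. The topology of `ι → ℝ` is the Euclidean one. -/

/-- The `ℓ₂` norm of a vector. -/
def l2norm {ι : Type*} [Fintype ι] (v : ι → ℝ) : ℝ := Real.sqrt (∑ i, v i ^ 2)

/-- The `ℓ₁` norm of a vector. -/
def l1norm {ι : Type*} [Fintype ι] (v : ι → ℝ) : ℝ := ∑ i, |v i|

open Classical in
/-- The convex-analytic indicator `ι_S`: `0` on `S` and `+∞` off `S`. -/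
def indic {E : Type*} (S : Set E) (x : E) : EReal := if x ∈ S then 0 else ⊤

/-- The set of minimizers of an extended-real-valued function; as usual, a function that is
identically `+∞` has none. -/
def argminSet {E : Type*} (F : E → EReal) : Set E := {x | F x ≠ ⊤ ∧ ∀ z, F x ≤ F z}

/-- Closed proper convex functions, through the epigraph. -/
structure IsClosedProperConvex {E : Type*} [AddCommGroup E] [Module ℝ E] [TopologicalSpace E]
    (f : E → EReal) : Prop where
  ne_bot : ∀ x, f x ≠ ⊥
  ne_top : ∃ x, f x ≠ ⊤
  convex_epigraph : Convex ℝ {p : E × ℝ | f p.1 ≤ (p.2 : EReal)}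
  closed_epigraph : IsClosed {p : E × ℝ | f p.1 ≤ (p.2 : EReal)}

/-- The closed Euclidean ball `B(y, δ)`. -/
def l2ball {k : ℕ} (y : Fin k → ℝ) (δ : ℝ) : Set (Fin k → ℝ) := {z | l2norm (z - y) ≤ δ}

/-- The nonnegative orthant. -/
def orthant (n : ℕ) : Set (Fin n → ℝ) := {v | ∀ i, 0 ≤ v i}

/-! ### The optimization problems -/

/-- The constraint set of CBPDN. -/
def cbpdnFeasible {k n : ℕ} (A : Matrix (Fin k) (Fin n) ℝ) (y : Fin k → ℝ) (δ : ℝ) :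
    Set (Fin n → ℝ) :=
  {x | l2norm (A *ᵥ x - y) ≤ δ ∧ (∀ i, 0 ≤ x i) ∧ ∑ i, x i = 1}

/-- The solutions of CBPDN: minimizers of the `ℓ₁` norm over the constraint set. -/
def cbpdnSolutions {k n : ℕ} (A : Matrix (Fin k) (Fin n) ℝ) (y : Fin k → ℝ) (δ : ℝ) :
    Set (Fin n → ℝ) :=
  {x | x ∈ cbpdnFeasible A y δ ∧ IsMinOn l1norm (cbpdnFeasible A y δ) x}

/-- The constraint set of CBP. -/
def cbpFeasible {k n : ℕ} (A : Matrix (Fin k) (Fin n) ℝ) (y : Fin k → ℝ) : Set (Fin n → ℝ) :=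
  {x | A *ᵥ x = y ∧ (∀ i, 0 ≤ x i) ∧ ∑ i, x i = 1}

/-- The solutions of CBP. -/
def cbpSolutions {k n : ℕ} (A : Matrix (Fin k) (Fin n) ℝ) (y : Fin k → ℝ) : Set (Fin n → ℝ) :=
  {x | x ∈ cbpFeasible A y ∧ IsMinOn l1norm (cbpFeasible A y) x}

/-! ### ADMM -/

/-- The objective of the first ADMM step, `f₁(x) + (μ/2) ‖G x - u - d‖₂²`. -/
def admmObjX {p n : Type*} [Fintype p] [Fintype n] (f₁ : (n → ℝ) → EReal) (G : Matrix p n ℝ)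
    (μ : ℝ) (u d : p → ℝ) (x : n → ℝ) : EReal :=
  f₁ x + ((μ / 2 * l2norm (G *ᵥ x - u - d) ^ 2 : ℝ) : EReal)

/-- The objective of the second ADMM step, `f₂(u) + (μ/2) ‖G x - u - d‖₂²`. -/
def admmObjU {p n : Type*} [Fintype p] [Fintype n] (f₂ : (p → ℝ) → EReal) (G : Matrix p n ℝ)
    (μ : ℝ) (x : n → ℝ) (d : p → ℝ) (u : p → ℝ) : EReal :=
  f₂ u + ((μ / 2 * l2norm (G *ᵥ x - u - d) ^ 2 : ℝ) : EReal)

/-- The sequences `x`, `u`, `d` satisfy the ADMM recursion for `min f₁(x) + f₂(G x)`.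
The entries `u 0`, `d 0` are the initialization; `x 0` plays no role. -/
structure IsADMM {p n : Type*} [Fintype p] [Fintype n] (f₁ : (n → ℝ) → EReal)
    (f₂ : (p → ℝ) → EReal) (G : Matrix p n ℝ) (μ : ℝ)
    (x : ℕ → n → ℝ) (u d : ℕ → p → ℝ) : Prop where
  x_step : ∀ j, x (j + 1) ∈ argminSet (admmObjX f₁ G μ (u j) (d j))
  u_step : ∀ j, u (j + 1) ∈ argminSet (admmObjU f₂ G μ (x (j + 1)) (d j))
  d_step : ∀ j, d (j + 1) = d j - (G *ᵥ x (j + 1) - u (j + 1))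

/-! ### The ADMM splitting of CBPDN -/

/-- `f₁(x) = ι_{1}(1ᵀx)`. -/
def csF1 {n : ℕ} (x : Fin n → ℝ) : EReal := indic {(1 : ℝ)} (∑ i, x i)

/-- `f₂(u) = ι_{B(y,δ)}(u₁) + lam ‖u₂‖₁ + ι_{ℝ₊ⁿ}(u₂)`, for `u = (u₁, u₂)`. -/
def csF2 {k n : ℕ} (y : Fin k → ℝ) (δ lam : ℝ) (u : Fin k ⊕ Fin n → ℝ) : EReal :=
  indic (l2ball y δ) (u ∘ Sum.inl) + ((lam * l1norm (u ∘ Sum.inr) : ℝ) : EReal)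
    + indic (orthant n) (u ∘ Sum.inr)

/-- `G = [Aᵀ I]ᵀ`: the matrix `A` stacked on top of the identity. -/
def csG {k n : ℕ} (A : Matrix (Fin k) (Fin n) ℝ) : Matrix (Fin k ⊕ Fin n) (Fin n) ℝ :=
  Matrix.fromRows A 1

/-! ### The C-SUnSAL algorithm -/

/-- `B = AᵀA + I`. -/
def csB {k n : ℕ} (A : Matrix (Fin k) (Fin n) ℝ) : Matrix (Fin n) (Fin n) ℝ := Aᵀ * A + 1

/-- `C = B⁻¹ 1 (1ᵀ B⁻¹ 1)⁻¹`. -/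
def csC {k n : ℕ} (A : Matrix (Fin k) (Fin n) ℝ) : Fin n → ℝ :=
  ((1 : Fin n → ℝ) ⬝ᵥ (csB A)⁻¹ *ᵥ 1)⁻¹ • ((csB A)⁻¹ *ᵥ 1)

/-- The update `x ← B⁻¹ w - C (1ᵀ B⁻¹ w - 1)` with
`w = Aᵀ (u₁ + d₁) + (u₂ + d₂)`. -/
def csXUpdate {k n : ℕ} (A : Matrix (Fin k) (Fin n) ℝ) (u₁ d₁ : Fin k → ℝ) (u₂ d₂ : Fin n → ℝ) :
    Fin n → ℝ :=
  let w : Fin n → ℝ := Aᵀ *ᵥ (u₁ + d₁) + (u₂ + d₂)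
  (csB A)⁻¹ *ᵥ w - ((1 : Fin n → ℝ) ⬝ᵥ (csB A)⁻¹ *ᵥ w - 1) • csC A

open Classical in
/-- The projection `ψ_{B(y,δ)}` onto the closed ball, in closed form. -/
def ballProj {k : ℕ} (y : Fin k → ℝ) (δ : ℝ) (ν : Fin k → ℝ) : Fin k → ℝ :=
  if l2norm (ν - y) ≤ δ then ν else y + (δ / l2norm (ν - y)) • (ν - y)

/-- The scalar soft threshold `soft(a, τ) = sign(a) max{|a| - τ, 0}`. -/
def soft (a τ : ℝ) : ℝ := Real.sign a * max (|a| - τ) 0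

/-- Nonnegative soft thresholding `max{0, soft(ν, τ)}`, componentwise. -/
def nonnegSoft {n : ℕ} (ν : Fin n → ℝ) (τ : ℝ) : Fin n → ℝ := fun i => max 0 (soft (ν i) τ)

/-- The sequences are generated by C-SUnSAL. The entries `u₁ 0`, `d₁ 0`, `u₂ 0`, `d₂ 0` are the
arbitrary initialization; `x 0` plays no role. -/
structure IsCSUnSAL {k n : ℕ} (A : Matrix (Fin k) (Fin n) ℝ) (y : Fin k → ℝ) (δ lam μ : ℝ)
    (x : ℕ → Fin n → ℝ) (u₁ d₁ : ℕ → Fin k → ℝ) (u₂ d₂ : ℕ → Fin n → ℝ) : Prop where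
  x_step : ∀ j, x (j + 1) = csXUpdate A (u₁ j) (d₁ j) (u₂ j) (d₂ j)
  u₁_step : ∀ j, u₁ (j + 1) = ballProj y δ (A *ᵥ x (j + 1) - d₁ j)
  u₂_step : ∀ j, u₂ (j + 1) = nonnegSoft (x (j + 1) - d₂ j) (lam / μ)
  d₁_step : ∀ j, d₁ (j + 1) = d₁ j - (A *ᵥ x (j + 1) - u₁ (j + 1))
  d₂_step : ∀ j, d₂ (j + 1) = d₂ j - (x (j + 1) - u₂ (j + 1))

end

/-!
On the feasible set `‖x‖₁ = 1ᵀx = 1`, so every feasible point solves CBPDN, and `(0, -lam 1)` is a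
Lagrange multiplier for it: a saddle point exists without any constraint qualification.

In the variable `a = G x`, ADMM is the Douglas–Rachford iteration for the two monotone operators
that the optimality conditions of the two minimizations define. For a solution `xs`, `p = G xs`
and a multiplier `μ q`, monotonicity shows that `‖u - p‖² + ‖d - q‖²` drops by at least
`‖G x - u‖²` in every step. Hence `(u, d)` is Fejér monotone and `G x - u → 0`. As the operators
have closed graphs, every cluster point of `(u, d)` is again such a pair `(p, q)`, so `(u, d)`
converges, and since `G` is injective so does `x`.
-/

section Fejer

theorem exists_tendsto_of_antitone_dist {X : Type*} [PseudoMetricSpace X] [ProperSpace X]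
    {F : Set X} (hF : F.Nonempty) {s : ℕ → X} (hanti : ∀ p ∈ F, Antitone fun j => dist (s j) p)
    (hcluster : ∀ (p : X) (φ : ℕ → ℕ), StrictMono φ → Tendsto (s ∘ φ) atTop (𝓝 p) → p ∈ F) :
    ∃ p ∈ F, Tendsto s atTop (𝓝 p) := by
  obtain ⟨c, hc⟩ := hF
  have hbounded : ∀ j, s j ∈ Metric.closedBall c (dist (s 0) c) := fun j => hanti c hc j.zero_le
  obtain ⟨p, -, φ, hφ, hφp⟩ := tendsto_subseq_of_bounded Metric.isBounded_closedBall hbounded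
  have hp : p ∈ F := hcluster p φ hφ hφp
  refine ⟨p, hp, tendsto_iff_dist_tendsto_zero.2 ?_⟩
  have hlim := tendsto_atTop_ciInf (hanti p hp) ⟨0, Set.forall_mem_range.2 fun _ => dist_nonneg⟩
  have hsub := tendsto_iff_dist_tendsto_zero.1 hφp
  rwa [tendsto_nhds_unique (hlim.comp hφ.tendsto_atTop) hsub] at hlim

theorem tendsto_zero_of_succ_le_sub {V c : ℕ → ℝ} (hV : ∀ j, 0 ≤ V j) (hc : ∀ j, 0 ≤ c j)
    (h : ∀ j, V (j + 1) ≤ V j - c j) : Tendsto c atTop (𝓝 0) := by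
  have hanti : Antitone V := antitone_nat_of_succ_le fun j => (h j).trans (sub_le_self _ (hc j))
  have hlim := tendsto_atTop_ciInf hanti ⟨0, Set.forall_mem_range.2 hV⟩
  have hdiff := hlim.sub ((tendsto_add_atTop_iff_nat 1).2 hlim)
  rw [sub_self] at hdiff
  exact squeeze_zero hc (fun j => le_sub_comm.1 (h j)) hdiff

end Fejer

section DouglasRachford

open scoped RealInnerProductSpace

variable {E : Type*} [NormedAddCommGroup E]

/-- The Douglas–Rachford iteration for the inclusion `0 ∈ S p + T p`, in the form in which ADMM
produces it. The resolvents are described by graph membership instead of being computed. -/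
structure IsDouglasRachford (S T : Set (E × E)) (a u e : ℕ → E) : Prop where
  fst_step : ∀ j, (a j, u j + e j - a j) ∈ S
  snd_step : ∀ j, (u (j + 1), -e (j + 1)) ∈ T
  dual_step : ∀ j, e (j + 1) = e j - (a j - u (j + 1))

/-- The Kuhn–Tucker pairs `(p, q)` with `q ∈ S p` and `-q ∈ T p`, in the `ℓ₂` product, in whose
metric the iteration is Fejér monotone. -/
def kuhnTuckerSet (S T : Set (E × E)) : Set (WithLp 2 (E × E)) :=
  {z | (z.fst, z.snd) ∈ S ∧ (z.fst, -z.snd) ∈ T}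

namespace IsDouglasRachford

variable {S T : Set (E × E)} {a u e : ℕ → E}

theorem mem_kuhnTuckerSet_of_tendsto (h : IsDouglasRachford S T a u e) (hS : IsClosed S)
    (hT : IsClosed T) (hau : Tendsto (fun j => a j - u j) atTop (𝓝 0))
    {z : WithLp 2 (E × E)} {φ : ℕ → ℕ} (hφ : StrictMono φ)
    (hz : Tendsto (fun i => WithLp.toLp 2 (u (φ i), e (φ i))) atTop (𝓝 z)) :
    z ∈ kuhnTuckerSet S T := by
  have hu : Tendsto (u ∘ φ) atTop (𝓝 z.fst) := ((WithLp.continuous_fst 2 E E).tendsto z).comp hz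
  have he : Tendsto (e ∘ φ) atTop (𝓝 z.snd) := ((WithLp.continuous_snd 2 E E).tendsto z).comp hz
  have hauφ : Tendsto (fun i => a (φ i) - u (φ i)) atTop (𝓝 0) := hau.comp hφ.tendsto_atTop
  have ha : Tendsto (a ∘ φ) atTop (𝓝 z.fst) := by
    simpa [Function.comp_def] using hauφ.add hu
  have hdual : Tendsto (fun i => u (φ i) + e (φ i) - a (φ i)) atTop (𝓝 z.snd) := by
    simpa [Function.comp_def] using (hu.add he).sub ha
  refine ⟨hS.mem_of_tendsto (ha.prodMk_nhds hdual) (.of_forall fun i => h.fst_step (φ i)),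
    hT.mem_of_tendsto (hu.prodMk_nhds he.neg) ?_⟩
  filter_upwards [hφ.tendsto_atTop.eventually_ge_atTop 1] with i hi
  simpa [Nat.sub_add_cancel hi] using h.snd_step (φ i - 1)

end IsDouglasRachford

variable [InnerProductSpace ℝ E]

/-- Monotone operators, given by their graph and not necessarily maximal. -/
def IsMonotoneGraph (S : Set (E × E)) : Prop :=
  ∀ ⦃v⦄, v ∈ S → ∀ ⦃w⦄, w ∈ S → 0 ≤ ⟪v.2 - w.2, v.1 - w.1⟫

theorem norm_sq_add_norm_sq_le_sub {a u e u' : E} (hS : 0 ≤ ⟪u + e - a, a⟫)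
    (hT : ⟪e - a + u', u'⟫ ≤ 0) :
    ‖u'‖ ^ 2 + ‖e - a + u'‖ ^ 2 ≤ ‖u‖ ^ 2 + ‖e‖ ^ 2 - ‖a - u‖ ^ 2 := by
  simp only [inner_add_left, inner_sub_left, real_inner_self_eq_norm_sq] at hS hT
  rw [norm_add_sq_real, norm_sub_sq_real, norm_sub_sq_real, inner_sub_left, real_inner_comm u a]
  linarith

namespace IsDouglasRachford

variable {S T : Set (E × E)} {a u e : ℕ → E}

theorem dist_sq_succ_le (h : IsDouglasRachford S T a u e) (hS : IsMonotoneGraph S)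
    (hT : IsMonotoneGraph T) {z : WithLp 2 (E × E)} (hz : z ∈ kuhnTuckerSet S T) (j : ℕ) :
    dist (WithLp.toLp 2 (u (j + 1), e (j + 1))) z ^ 2 ≤
      dist (WithLp.toLp 2 (u j, e j)) z ^ 2 - ‖a j - u j‖ ^ 2 := by
  have hS' : 0 ≤ ⟪u j - z.fst + (e j - z.snd) - (a j - z.fst), a j - z.fst⟫ := by
    convert hS (h.fst_step j) hz.1 using 2
    dsimp only
    abel
  have hdual : e (j + 1) - z.snd = e j - z.snd - (a j - z.fst) + (u (j + 1) - z.fst) := by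
    rw [h.dual_step j]
    abel
  have hT' : ⟪e j - z.snd - (a j - z.fst) + (u (j + 1) - z.fst), u (j + 1) - z.fst⟫ ≤ 0 := by
    rw [← hdual, ← neg_nonneg, ← inner_neg_left]
    convert hT (h.snd_step j) hz.2 using 2
    dsimp only
    abel
  have hstep := norm_sq_add_norm_sq_le_sub hS' hT'
  rw [← hdual, sub_sub_sub_cancel_right] at hstep
  simp only [dist_eq_norm, WithLp.prod_norm_sq_eq_of_L2]
  exact hstep

theorem antitone_dist (h : IsDouglasRachford S T a u e) (hS : IsMonotoneGraph S)
    (hT : IsMonotoneGraph T) {z : WithLp 2 (E × E)} (hz : z ∈ kuhnTuckerSet S T) :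
    Antitone fun j => dist (WithLp.toLp 2 (u j, e j)) z :=
  antitone_nat_of_succ_le fun j => le_of_sq_le_sq
    ((h.dist_sq_succ_le hS hT hz j).trans (sub_le_self _ (sq_nonneg _))) dist_nonneg

theorem tendsto_sub (h : IsDouglasRachford S T a u e) (hS : IsMonotoneGraph S)
    (hT : IsMonotoneGraph T) (hne : (kuhnTuckerSet S T).Nonempty) :
    Tendsto (fun j => a j - u j) atTop (𝓝 0) := by
  obtain ⟨z, hz⟩ := hne
  have hsq : Tendsto (fun j => ‖a j - u j‖ ^ 2) atTop (𝓝 0) :=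
    tendsto_zero_of_succ_le_sub (V := fun j => dist (WithLp.toLp 2 (u j, e j)) z ^ 2)
      (fun _ => sq_nonneg _) (fun _ => sq_nonneg _) (h.dist_sq_succ_le hS hT hz)
  simpa [tendsto_zero_iff_norm_tendsto_zero] using hsq.sqrt

theorem exists_tendsto [FiniteDimensional ℝ E] (h : IsDouglasRachford S T a u e)
    (hS : IsMonotoneGraph S) (hS' : IsClosed S) (hT : IsMonotoneGraph T) (hT' : IsClosed T)
    (hne : (kuhnTuckerSet S T).Nonempty) :
    ∃ z ∈ kuhnTuckerSet S T, Tendsto a atTop (𝓝 z.fst) := by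
  have : ProperSpace (WithLp 2 (E × E)) := FiniteDimensional.proper_real _
  have hau := h.tendsto_sub hS hT hne
  obtain ⟨z, hz, hlim⟩ := exists_tendsto_of_antitone_dist
    (s := fun j => WithLp.toLp 2 (u j, e j)) hne
    (fun _ hz => h.antitone_dist hS hT hz)
    (fun _ _ hφ hlim => h.mem_kuhnTuckerSet_of_tendsto hS' hT' hau hφ hlim)
  have hu : Tendsto u atTop (𝓝 z.fst) := ((WithLp.continuous_fst 2 E E).tendsto z).comp hlim
  exact ⟨z, hz, by simpa using hau.add hu⟩

end IsDouglasRachford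

end DouglasRachford

section Norms

variable {ι : Type*} [Fintype ι]

theorem l2norm_eq_norm_toLp (v : ι → ℝ) : l2norm v = ‖WithLp.toLp 2 v‖ := by
  simp [l2norm, EuclideanSpace.norm_eq]

theorem l2norm_nonneg (v : ι → ℝ) : 0 ≤ l2norm v := Real.sqrt_nonneg _

theorem l2norm_eq_zero {v : ι → ℝ} : l2norm v = 0 ↔ v = 0 := by
  rw [l2norm_eq_norm_toLp, norm_eq_zero, WithLp.toLp_eq_zero]

theorem l2norm_smul (c : ℝ) (v : ι → ℝ) : l2norm (c • v) = |c| * l2norm v := by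
  rw [l2norm_eq_norm_toLp, WithLp.toLp_smul, norm_smul, ← l2norm_eq_norm_toLp, Real.norm_eq_abs]

theorem l2norm_sub_comm (v w : ι → ℝ) : l2norm (v - w) = l2norm (w - v) := by
  simp only [l2norm_eq_norm_toLp, WithLp.toLp_sub, norm_sub_rev]

theorem continuous_l2norm : Continuous (l2norm : (ι → ℝ) → ℝ) := by
  unfold l2norm
  fun_prop

theorem l2norm_sq (v : ι → ℝ) : l2norm v ^ 2 = v ⬝ᵥ v := by
  rw [l2norm, Real.sq_sqrt (Finset.sum_nonneg fun i _ => sq_nonneg _)]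
  simp only [dotProduct, sq]

theorem l2norm_add_sq (v w : ι → ℝ) :
    l2norm (v + w) ^ 2 = l2norm v ^ 2 + 2 * (v ⬝ᵥ w) + l2norm w ^ 2 := by
  simp only [l2norm_sq, dotProduct_add, add_dotProduct, dotProduct_comm w v]
  ring

theorem dotProduct_le_l2norm_mul_l2norm (v w : ι → ℝ) : v ⬝ᵥ w ≤ l2norm v * l2norm w := by
  have h := real_inner_le_norm (WithLp.toLp 2 w) (WithLp.toLp 2 v)
  rwa [EuclideanSpace.inner_toLp_toLp, star_trivial, ← l2norm_eq_norm_toLp,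
    ← l2norm_eq_norm_toLp, mul_comm] at h

theorem l1norm_eq_sum {v : ι → ℝ} (h : ∀ i, 0 ≤ v i) : l1norm v = ∑ i, v i :=
  Finset.sum_congr rfl fun i _ => abs_of_nonneg (h i)

theorem transpose_mulVec_dotProduct {κ : Type*} [Fintype κ] (G : Matrix κ ι ℝ) (v : κ → ℝ)
    (x : ι → ℝ) : (Gᵀ *ᵥ v) ⬝ᵥ x = v ⬝ᵥ G *ᵥ x := by
  rw [mulVec_transpose, ← dotProduct_mulVec]

end Norms

section Indicators

variable {E : Type*} {S : Set E} {x : E}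

theorem indic_of_mem (h : x ∈ S) : indic S x = 0 := if_pos h

theorem indic_of_notMem (h : x ∉ S) : indic S x = ⊤ := if_neg h

theorem indic_inter (S T : Set E) (x : E) : indic (S ∩ T) x = indic S x + indic T x := by
  by_cases hS : x ∈ S <;> by_cases hT : x ∈ T <;> simp [indic, hS, hT]

theorem coe_add_indic_ne_bot (a : ℝ) (S : Set E) (x : E) : (a : EReal) + indic S x ≠ ⊥ := by
  by_cases hx : x ∈ S <;> simp [indic, hx]

theorem coe_add_indic_le_coe_iff {a r : ℝ} : (a : EReal) + indic S x ≤ r ↔ x ∈ S ∧ a ≤ r := by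
  by_cases hx : x ∈ S <;> simp [indic, hx]

theorem coe_le_coe_add_indic_iff {a r : ℝ} :
    (r : EReal) ≤ a + indic S x ↔ x ∈ S → r ≤ a := by
  by_cases hx : x ∈ S <;> simp [indic, hx]

theorem argminSet_eq_singleton {F : E → EReal} (hx : F x ≠ ⊤) (h : ∀ z, z ≠ x → F x < F z) :
    argminSet F = {x} := by
  refine Set.eq_singleton_iff_unique_mem.2 ⟨⟨hx, fun z => ?_⟩, fun z hz => ?_⟩
  · obtain rfl | hzx := eq_or_ne z x
    exacts [le_rfl, (h z hzx).le]
  · by_contra hzx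
    exact (h z hzx).not_ge (hz.2 x)

theorem argminSet_coe_add_indic (φ : E → ℝ) (S : Set E) :
    argminSet (fun x => (φ x : EReal) + indic S x) = {x | x ∈ S ∧ IsMinOn φ S x} := by
  ext x
  by_cases hx : x ∈ S
  · simp [argminSet, IsMinOn, IsMinFilter, indic_of_mem hx, hx, coe_le_coe_add_indic_iff]
  · simp [argminSet, indic_of_notMem hx, hx]

theorem setOf_isMinOn_eq_of_forall_eq {φ : E → ℝ} {c : ℝ} (h : ∀ x ∈ S, φ x = c) :
    {x | x ∈ S ∧ IsMinOn φ S x} = S :=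
  Set.sep_eq_self_iff_mem_true.2 fun x hx z hz => ((h x hx).trans (h z hz).symm).le

theorem isClosedProperConvex_coe_add_indic [AddCommGroup E] [Module ℝ E] [TopologicalSpace E]
    {φ : E → ℝ} (hφ : ConvexOn ℝ S φ) (hφc : LowerSemicontinuousOn φ S) (hS : IsClosed S)
    (hne : S.Nonempty) : IsClosedProperConvex fun x => (φ x : EReal) + indic S x where
  ne_bot x := coe_add_indic_ne_bot (φ x) S x
  ne_top := by
    obtain ⟨x, hx⟩ := hne
    exact ⟨x, by simp [indic_of_mem hx]⟩
  convex_epigraph := by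
    simpa only [coe_add_indic_le_coe_iff] using hφ.convex_epigraph
  closed_epigraph := by
    simpa only [coe_add_indic_le_coe_iff] using
      (lowerSemicontinuousOn_iff_isClosed_epigraph hS).1 hφc

theorem isClosedProperConvex_indic [AddCommGroup E] [Module ℝ E] [TopologicalSpace E]
    (hconv : Convex ℝ S) (hS : IsClosed S) (hne : S.Nonempty) :
    IsClosedProperConvex (indic S) := by
  simpa only [EReal.coe_zero, zero_add] using
    isClosedProperConvex_coe_add_indic (convexOn_const 0 hconv)
      lowerSemicontinuousOn_const hS hne

end Indicators

section Subdifferential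

variable {ι : Type*} [Fintype ι]

/-- The subdifferential of convex analysis, with respect to the dot product. The value at `x` is
required to be finite, so that the subdifferential is empty off the effective domain. -/
def subdifferential (f : (ι → ℝ) → EReal) (x : ι → ℝ) : Set (ι → ℝ) :=
  {g | ∃ r : ℝ, f x = r ∧ ∀ z, ((r + g ⬝ᵥ (z - x) : ℝ) : EReal) ≤ f z}

variable {f : (ι → ℝ) → EReal} {x z g h : ι → ℝ}

theorem mem_subdifferential_coe_add_indic {φ : (ι → ℝ) → ℝ} {S : Set (ι → ℝ)} :
    g ∈ subdifferential (fun x => (φ x : EReal) + indic S x) x ↔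
      x ∈ S ∧ ∀ z ∈ S, φ x + g ⬝ᵥ (z - x) ≤ φ z := by
  constructor
  · rintro ⟨r, hr, h⟩
    have hx : x ∈ S := (coe_add_indic_le_coe_iff.1 hr.le).1
    obtain rfl : φ x = r := by simpa only [indic_of_mem hx, add_zero, EReal.coe_eq_coe_iff] using hr
    exact ⟨hx, fun z => coe_le_coe_add_indic_iff.1 (h z)⟩
  · rintro ⟨hx, h⟩
    exact ⟨φ x, by simp only [indic_of_mem hx, add_zero], fun z => coe_le_coe_add_indic_iff.2 (h z)⟩

theorem mem_subdifferential_indic {S : Set (ι → ℝ)} :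
    g ∈ subdifferential (indic S) x ↔ x ∈ S ∧ ∀ z ∈ S, g ⬝ᵥ (z - x) ≤ 0 := by
  simpa using mem_subdifferential_coe_add_indic (g := g) (x := x) (φ := 0) (S := S)

theorem sumElim_mem_subdifferential {κ : Type*} [Fintype κ] {f₁ : (ι → ℝ) → EReal}
    {f₂ : (κ → ℝ) → EReal} {x₁ g₁ : ι → ℝ} {x₂ g₂ : κ → ℝ} (h₁ : g₁ ∈ subdifferential f₁ x₁)
    (h₂ : g₂ ∈ subdifferential f₂ x₂) :
    Sum.elim g₁ g₂ ∈ subdifferential (fun x => f₁ (x ∘ Sum.inl) + f₂ (x ∘ Sum.inr))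
      (Sum.elim x₁ x₂) := by
  obtain ⟨r₁, hr₁, h₁⟩ := h₁
  obtain ⟨r₂, hr₂, h₂⟩ := h₂
  refine ⟨r₁ + r₂, by simp only [Sum.elim_comp_inl, Sum.elim_comp_inr, hr₁, hr₂, EReal.coe_add],
    fun z => ?_⟩
  have hsplit : Sum.elim g₁ g₂ ⬝ᵥ (z - Sum.elim x₁ x₂) =
      g₁ ⬝ᵥ (z ∘ Sum.inl - x₁) + g₂ ⬝ᵥ (z ∘ Sum.inr - x₂) := by
    rw [← sumElim_dotProduct_sumElim, Sum.elim_sub_sub, Sum.elim_comp_inl_inr]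
  rw [hsplit, add_add_add_comm, EReal.coe_add]
  exact add_le_add (h₁ _) (h₂ _)

theorem dotProduct_sub_nonneg_of_mem_subdifferential (hg : g ∈ subdifferential f x)
    (hh : h ∈ subdifferential f z) : 0 ≤ (g - h) ⬝ᵥ (x - z) := by
  obtain ⟨r, hr, hg⟩ := hg
  obtain ⟨s, hs, hh⟩ := hh
  have hrs := hs ▸ hg z
  have hsr := hr ▸ hh x
  rw [EReal.coe_le_coe_iff, ← neg_sub x z, dotProduct_neg] at hrs
  rw [EReal.coe_le_coe_iff] at hsr
  rw [sub_dotProduct]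
  linarith

theorem mem_subdifferential_iff_forall_epigraph (hbot : ∀ x, f x ≠ ⊥) (htop : ∃ x, f x ≠ ⊤) :
    g ∈ subdifferential f x ↔
      ∀ z (r : ℝ), f z ≤ r → f x ≤ ((r - g ⬝ᵥ (z - x) : ℝ) : EReal) := by
  constructor
  · rintro ⟨s, hs, h⟩ z r hr
    rw [hs, EReal.coe_le_coe_iff, le_sub_iff_add_le]
    exact EReal.coe_le_coe_iff.1 ((h z).trans hr)
  · intro h
    have hx : f x ≠ ⊤ := by
      obtain ⟨z, hz⟩ := htop
      exact ((h z _ (EReal.le_coe_toReal hz)).trans_lt (EReal.coe_lt_top _)).ne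
    refine ⟨(f x).toReal, (EReal.coe_toReal hx (hbot x)).symm, fun z => ?_⟩
    by_cases hz : f z = ⊤
    · exact hz ▸ le_top
    · have hxz := h z _ (EReal.le_coe_toReal hz)
      rw [← EReal.coe_toReal hx (hbot x), EReal.coe_le_coe_iff, le_sub_iff_add_le] at hxz
      rwa [← EReal.coe_toReal hz (hbot z), EReal.coe_le_coe_iff]

theorem isClosed_graph_subdifferential (hf : IsClosedProperConvex f) :
    IsClosed {q : (ι → ℝ) × (ι → ℝ) | q.2 ∈ subdifferential f q.1} := by
  simp only [mem_subdifferential_iff_forall_epigraph hf.ne_bot hf.ne_top, Set.ofPred_forall]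
  refine isClosed_iInter fun z => isClosed_iInter fun r => isClosed_iInter fun _ => ?_
  exact hf.closed_epigraph.preimage
    (f := fun q : (ι → ℝ) × (ι → ℝ) => (q.1, r - q.2 ⬝ᵥ (z - q.1))) (by fun_prop)

variable {κ : Type*} [Fintype κ] {G : Matrix κ ι ℝ} {μ : ℝ}

theorem argminSet_add_sq_eq_singleton (hG : Function.Injective G.mulVec) (hμ : 0 < μ)
    {w : κ → ℝ} (hx : μ • (Gᵀ *ᵥ (w - G *ᵥ x)) ∈ subdifferential f x) :
    argminSet (fun z => f z + ((μ / 2 * l2norm (G *ᵥ z - w) ^ 2 : ℝ) : EReal)) = {x} := by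
  obtain ⟨r, hr, hsub⟩ := hx
  refine argminSet_eq_singleton (hr ▸ EReal.coe_ne_top _) fun z hz => ?_
  have hpos : 0 < l2norm (G *ᵥ (z - x)) := by
    refine (l2norm_nonneg _).lt_of_ne' fun h => hz (sub_eq_zero.1 (hG ?_))
    rw [l2norm_eq_zero.1 h, mulVec_zero]
  have hsq : l2norm (G *ᵥ z - w) ^ 2 = l2norm (G *ᵥ x - w) ^ 2
      - 2 * ((w - G *ᵥ x) ⬝ᵥ G *ᵥ (z - x)) + l2norm (G *ᵥ (z - x)) ^ 2 := by
    have hsplit : G *ᵥ z - w = (G *ᵥ x - w) + G *ᵥ (z - x) := by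
      rw [mulVec_sub]
      abel
    rw [hsplit, l2norm_add_sq, ← neg_sub w, neg_dotProduct]
    ring
  have hlt : r + μ / 2 * l2norm (G *ᵥ x - w) ^ 2 <
      r + (μ • (Gᵀ *ᵥ (w - G *ᵥ x))) ⬝ᵥ (z - x) + μ / 2 * l2norm (G *ᵥ z - w) ^ 2 := by
    rw [smul_dotProduct, transpose_mulVec_dotProduct, hsq, smul_eq_mul]
    have : 0 < μ * l2norm (G *ᵥ (z - x)) ^ 2 := by positivity
    linarith
  calc f x + ((μ / 2 * l2norm (G *ᵥ x - w) ^ 2 : ℝ) : EReal)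
      = ((r + μ / 2 * l2norm (G *ᵥ x - w) ^ 2 : ℝ) : EReal) := by rw [hr, EReal.coe_add]
    _ < _ := EReal.coe_lt_coe_iff.2 hlt
    _ ≤ f z + ((μ / 2 * l2norm (G *ᵥ z - w) ^ 2 : ℝ) : EReal) := by
      rw [EReal.coe_add]
      exact add_le_add_left (hsub z) _

theorem argminSet_add_sq_sub_eq_singleton (hμ : 0 < μ) {w : ι → ℝ}
    (hx : μ • (w - x) ∈ subdifferential f x) :
    argminSet (fun z => f z + ((μ / 2 * l2norm (z - w) ^ 2 : ℝ) : EReal)) = {x} := by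
  classical
  simpa only [one_mulVec] using argminSet_add_sq_eq_singleton (G := 1) (w := w) (x := x)
    (fun v w h => by simpa only [one_mulVec] using h) hμ
    (by simpa only [transpose_one, one_mulVec] using hx)

theorem nonneg_of_forall_nonneg_add_mul {a c : ℝ} (h : ∀ t ∈ Set.Ioc (0 : ℝ) 1, 0 ≤ a + t * c) :
    0 ≤ a := by
  have hlim : Tendsto (fun t : ℝ => a + t * c) (𝓝[>] 0) (𝓝 (a + 0 * c)) :=
    ((continuous_const.add (continuous_id.mul continuous_const)).tendsto 0).mono_left
      nhdsWithin_le_nhds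
  rw [zero_mul, add_zero] at hlim
  exact ge_of_tendsto hlim (mem_of_superset (Ioc_mem_nhdsGT one_pos) h)

theorem smul_transpose_mulVec_mem_subdifferential_of_mem_argminSet (hbot : ∀ x, f x ≠ ⊥)
    (hconv : Convex ℝ {p : (ι → ℝ) × ℝ | f p.1 ≤ (p.2 : EReal)}) {w : κ → ℝ}
    (hx : x ∈ argminSet fun z => f z + ((μ / 2 * l2norm (G *ᵥ z - w) ^ 2 : ℝ) : EReal)) :
    μ • (Gᵀ *ᵥ (w - G *ᵥ x)) ∈ subdifferential f x := by
  obtain ⟨hx, hmin⟩ := hx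
  dsimp only at hx hmin
  have hfx : f x ≠ ⊤ := fun h => hx (by rw [h, EReal.top_add_coe])
  have hr := (EReal.coe_toReal hfx (hbot x)).symm
  set r := (f x).toReal
  refine ⟨r, hr, fun z => ?_⟩
  by_cases hz : f z = ⊤
  · exact hz ▸ le_top
  have hs := (EReal.coe_toReal hz (hbot z)).symm
  set s := (f z).toReal
  rw [hs, EReal.coe_le_coe_iff, smul_dotProduct, transpose_mulVec_dotProduct, smul_eq_mul,
    ← sub_nonneg]
  refine nonneg_of_forall_nonneg_add_mul (c := μ / 2 * l2norm (G *ᵥ (z - x)) ^ 2) fun t ht => ?_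
  have hseg : f (x + t • (z - x)) ≤ ((r + t * (s - r) : ℝ) : EReal) :=
    hconv.add_smul_sub_mem (x := (x, r)) (y := (z, s)) hr.le hs.le (Set.Ioc_subset_Icc_self ht)
  have hle : r + μ / 2 * l2norm (G *ᵥ x - w) ^ 2 ≤
      r + t * (s - r) + μ / 2 * l2norm (G *ᵥ (x + t • (z - x)) - w) ^ 2 := by
    have := (hmin (x + t • (z - x))).trans (add_le_add_left hseg _)
    rw [hr] at this
    exact EReal.coe_le_coe_iff.1 this
  have hsplit : G *ᵥ (x + t • (z - x)) - w = (G *ᵥ x - w) + t • (G *ᵥ (z - x)) := by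
    rw [mulVec_add, mulVec_smul]
    abel
  rw [hsplit, l2norm_add_sq, l2norm_smul, dotProduct_smul, mul_pow, sq_abs, smul_eq_mul,
    ← neg_sub w, neg_dotProduct] at hle
  refine (mul_nonneg_iff_of_pos_left ht.1).1 ?_
  linarith

theorem smul_sub_mem_subdifferential_of_mem_argminSet (hbot : ∀ x, f x ≠ ⊥)
    (hconv : Convex ℝ {p : (ι → ℝ) × ℝ | f p.1 ≤ (p.2 : EReal)}) {w : ι → ℝ}
    (hx : x ∈ argminSet fun z => f z + ((μ / 2 * l2norm (z - w) ^ 2 : ℝ) : EReal)) :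
    μ • (w - x) ∈ subdifferential f x := by
  classical
  simpa only [transpose_one, one_mulVec] using
    smul_transpose_mulVec_mem_subdifferential_of_mem_argminSet (G := 1) (w := w) hbot hconv
      (by simpa only [one_mulVec] using hx)

end Subdifferential

section ADMM

variable {n p : Type*} [Fintype n] [Fintype p] {f f₁ : (n → ℝ) → EReal} {f₂ : (p → ℝ) → EReal}
  {G : Matrix p n ℝ} {μ : ℝ}

/-- A solution `x` of `min f₁(x) + f₂(G x)` with a Lagrange multiplier `g`. -/
structure IsKKTPair (f₁ : (n → ℝ) → EReal) (f₂ : (p → ℝ) → EReal) (G : Matrix p n ℝ)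
    (x : n → ℝ) (g : p → ℝ) : Prop where
  fst_mem : Gᵀ *ᵥ g ∈ subdifferential f₁ x
  snd_mem : -g ∈ subdifferential f₂ (G *ᵥ x)

theorem IsKKTPair.mem_argminSet {x : n → ℝ} {g : p → ℝ} (h : IsKKTPair f₁ f₂ G x g) :
    x ∈ argminSet fun z => f₁ z + f₂ (G *ᵥ z) := by
  obtain ⟨⟨r₁, hr₁, h₁⟩, ⟨r₂, hr₂, h₂⟩⟩ := h
  have hx : f₁ x + f₂ (G *ᵥ x) = ((r₁ + r₂ : ℝ) : EReal) := by rw [hr₁, hr₂, EReal.coe_add]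
  refine ⟨hx.trans_ne (EReal.coe_ne_top _), fun z => hx.trans_le ?_⟩
  have hcancel : r₁ + r₂ =
      r₁ + (Gᵀ *ᵥ g) ⬝ᵥ (z - x) + (r₂ + -g ⬝ᵥ (G *ᵥ z - G *ᵥ x)) := by
    rw [transpose_mulVec_dotProduct, mulVec_sub, neg_dotProduct]
    ring
  rw [hcancel, EReal.coe_add]
  exact add_le_add (h₁ z) (h₂ (G *ᵥ z))

theorem admmObjX_eq (f₁ : (n → ℝ) → EReal) (G : Matrix p n ℝ) (μ : ℝ) (u d : p → ℝ) :
    admmObjX f₁ G μ u d =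
      fun x => f₁ x + ((μ / 2 * l2norm (G *ᵥ x - (u + d)) ^ 2 : ℝ) : EReal) := by
  funext x
  rw [admmObjX, sub_sub]

theorem admmObjU_eq (f₂ : (p → ℝ) → EReal) (G : Matrix p n ℝ) (μ : ℝ) (x : n → ℝ) (d : p → ℝ) :
    admmObjU f₂ G μ x d =
      fun u => f₂ u + ((μ / 2 * l2norm (u - (G *ᵥ x - d)) ^ 2 : ℝ) : EReal) := by
  funext u
  rw [admmObjU, sub_right_comm, l2norm_sub_comm]

/-- The graph of the operator whose resolvent is `v ↦ G x`, with `x` a minimizer of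
`f(x) + (μ/2) ‖G x - v‖₂²`. -/
def proxGraph (f : (n → ℝ) → EReal) (G : Matrix p n ℝ) (μ : ℝ) :
    Set (EuclideanSpace ℝ p × EuclideanSpace ℝ p) :=
  Prod.map (fun x => WithLp.toLp 2 (G *ᵥ x)) id ''
    {q : (n → ℝ) × EuclideanSpace ℝ p | μ • (Gᵀ *ᵥ q.2.ofLp) ∈ subdifferential f q.1}

theorem mem_proxGraph {v e : EuclideanSpace ℝ p} :
    (v, e) ∈ proxGraph f G μ ↔
      ∃ x, μ • (Gᵀ *ᵥ e.ofLp) ∈ subdifferential f x ∧ WithLp.toLp 2 (G *ᵥ x) = v := by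
  simp [proxGraph, Prod.ext_iff]

theorem mem_proxGraph_one [DecidableEq n] {v e : EuclideanSpace ℝ n} :
    (v, e) ∈ proxGraph f 1 μ ↔ μ • e.ofLp ∈ subdifferential f v.ofLp := by
  simp only [mem_proxGraph, transpose_one, one_mulVec]
  exact ⟨fun ⟨_, hx, hxv⟩ => hxv ▸ hx, fun h => ⟨v.ofLp, h, rfl⟩⟩

theorem isMonotoneGraph_proxGraph (f : (n → ℝ) → EReal) (G : Matrix p n ℝ) (hμ : 0 < μ) :
    IsMonotoneGraph (proxGraph f G μ) := by
  rintro - ⟨⟨x, e⟩, hx, rfl⟩ - ⟨⟨x', e'⟩, hx', rfl⟩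
  have hmono := dotProduct_sub_nonneg_of_mem_subdifferential hx hx'
  rw [← smul_sub, ← mulVec_sub, smul_dotProduct, transpose_mulVec_dotProduct, mulVec_sub,
    smul_eq_mul, mul_nonneg_iff_of_pos_left hμ, dotProduct_comm] at hmono
  simpa [EuclideanSpace.inner_eq_star_dotProduct] using hmono

theorem isClosed_proxGraph (hf : IsClosedProperConvex f) (hG : Function.Injective G.mulVec)
    (μ : ℝ) : IsClosed (proxGraph f G μ) := by
  have hemb : IsClosedEmbedding fun x : n → ℝ => (WithLp.toLp 2 (G *ᵥ x) : EuclideanSpace ℝ p) :=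
    ((WithLp.linearEquiv 2 ℝ (p → ℝ)).symm.toLinearMap ∘ₗ
      G.mulVecLin).isClosedEmbedding_of_injective (LinearMap.ker_eq_bot.2
        ((WithLp.linearEquiv 2 ℝ (p → ℝ)).symm.injective.comp hG))
  refine (hemb.prodMap .id).isClosedMap _ ((isClosed_graph_subdifferential hf).preimage
    (f := fun q : (n → ℝ) × EuclideanSpace ℝ p => (q.1, μ • (Gᵀ *ᵥ q.2.ofLp))) ?_)
  fun_prop

theorem mem_kuhnTuckerSet_proxGraph [DecidableEq p]
    {z : WithLp 2 (EuclideanSpace ℝ p × EuclideanSpace ℝ p)} :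
    z ∈ kuhnTuckerSet (proxGraph f₁ G μ) (proxGraph f₂ 1 μ) ↔
      ∃ x, IsKKTPair f₁ f₂ G x (μ • z.snd.ofLp) ∧ WithLp.toLp 2 (G *ᵥ x) = z.fst := by
  rw [kuhnTuckerSet, Set.mem_ofPred_eq, mem_proxGraph, mem_proxGraph_one, WithLp.ofLp_neg,
    smul_neg]
  constructor
  · rintro ⟨⟨x, hx, hxz⟩, hz⟩
    exact ⟨x, ⟨by rwa [mulVec_smul], by rwa [← hxz] at hz⟩, hxz⟩
  · rintro ⟨x, ⟨hx, hGx⟩, hxz⟩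
    exact ⟨⟨x, by rwa [mulVec_smul] at hx, hxz⟩, hxz ▸ hGx⟩

namespace IsADMM

variable {x : ℕ → n → ℝ} {u d : ℕ → p → ℝ}

theorem isDouglasRachford [DecidableEq p] (h : IsADMM f₁ f₂ G μ x u d)
    (h₁ : IsClosedProperConvex f₁) (h₂ : IsClosedProperConvex f₂) :
    IsDouglasRachford (proxGraph f₁ G μ) (proxGraph f₂ 1 μ)
      (fun j => WithLp.toLp 2 (G *ᵥ x (j + 1))) (fun j => WithLp.toLp 2 (u j))
      (fun j => WithLp.toLp 2 (d j)) where
  fst_step j := by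
    refine mem_proxGraph.2 ⟨x (j + 1), ?_, rfl⟩
    refine smul_transpose_mulVec_mem_subdifferential_of_mem_argminSet (w := u j + d j) h₁.ne_bot
      h₁.convex_epigraph ?_
    simpa only [admmObjX_eq] using h.x_step j
  snd_step j := by
    have hdual : -d (j + 1) = G *ᵥ x (j + 1) - d j - u (j + 1) := by
      rw [h.d_step j]
      abel
    rw [mem_proxGraph_one, WithLp.ofLp_neg, hdual]
    refine smul_sub_mem_subdifferential_of_mem_argminSet h₂.ne_bot h₂.convex_epigraph ?_
    simpa only [admmObjU_eq] using h.u_step j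
  dual_step j := congrArg (WithLp.toLp 2) (h.d_step j)

theorem exists_tendsto (h : IsADMM f₁ f₂ G μ x u d) (hμ : 0 < μ)
    (h₁ : IsClosedProperConvex f₁) (h₂ : IsClosedProperConvex f₂)
    (hG : Function.Injective G.mulVec) (hKKT : ∃ xs g, IsKKTPair f₁ f₂ G xs g) :
    ∃ xs g, IsKKTPair f₁ f₂ G xs g ∧ Tendsto x atTop (𝓝 xs) := by
  classical
  have hne : (kuhnTuckerSet (proxGraph f₁ G μ) (proxGraph f₂ 1 μ)).Nonempty := by
    obtain ⟨xs, g, hxs⟩ := hKKT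
    refine ⟨WithLp.toLp 2 (WithLp.toLp 2 (G *ᵥ xs), WithLp.toLp 2 (μ⁻¹ • g)),
      mem_kuhnTuckerSet_proxGraph.2 ⟨xs, ?_, rfl⟩⟩
    rwa [← smul_inv_smul₀ hμ.ne' g] at hxs
  obtain ⟨z, hz, hlim⟩ := (h.isDouglasRachford h₁ h₂).exists_tendsto
    (isMonotoneGraph_proxGraph f₁ G hμ) (isClosed_proxGraph h₁ hG μ)
    (isMonotoneGraph_proxGraph f₂ 1 hμ)
    (isClosed_proxGraph h₂ (mulVec_injective_iff_isUnit.2 isUnit_one) μ) hne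
  obtain ⟨xs, hxs, hxz⟩ := mem_kuhnTuckerSet_proxGraph.1 hz
  refine ⟨xs, _, hxs, (tendsto_add_atTop_iff_nat 1).1 ?_⟩
  have hemb := G.mulVecLin.isClosedEmbedding_of_injective (LinearMap.ker_eq_bot.2 hG)
  rw [← hxz] at hlim
  exact hemb.tendsto_nhds_iff.2 (((PiLp.continuous_ofLp 2 fun _ : p => ℝ).tendsto _).comp hlim)

end IsADMM

end ADMM

section Prox

variable {k n : ℕ}

theorem convex_l2ball (y : Fin k → ℝ) (δ : ℝ) : Convex ℝ (l2ball y δ) := by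
  have hball : l2ball y δ = WithLp.toLp 2 ⁻¹' Metric.closedBall (WithLp.toLp 2 y) δ := by
    ext z
    simp [l2ball, l2norm_eq_norm_toLp, dist_eq_norm]
  rw [hball]
  exact (convex_closedBall _ δ).is_linear_preimage ⟨fun _ _ => rfl, fun _ _ => rfl⟩

theorem isClosed_l2ball (y : Fin k → ℝ) (δ : ℝ) : IsClosed (l2ball y δ) :=
  isClosed_le (continuous_l2norm.comp (continuous_id.sub continuous_const)) continuous_const

theorem center_mem_l2ball (y : Fin k → ℝ) {δ : ℝ} (hδ : 0 ≤ δ) : y ∈ l2ball y δ := by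
  rwa [l2ball, Set.mem_ofPred_eq, sub_self, l2norm_eq_zero.2 rfl]

theorem convex_orthant (n : ℕ) : Convex ℝ (orthant n) := convex_Ici (0 : Fin n → ℝ)

theorem isClosed_orthant (n : ℕ) : IsClosed (orthant n) := isClosed_Ici (a := (0 : Fin n → ℝ))

theorem ballProj_mem {δ : ℝ} (hδ : 0 ≤ δ) (y ν : Fin k → ℝ) : ballProj y δ ν ∈ l2ball y δ := by
  unfold ballProj
  split_ifs with h
  · exact h
  · have hpos : 0 < l2norm (ν - y) := hδ.trans_lt (not_le.1 h)
    rw [l2ball, Set.mem_ofPred_eq, add_sub_cancel_left, l2norm_smul,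
      abs_of_nonneg (by positivity), div_mul_cancel₀ _ hpos.ne']

theorem sub_ballProj_dotProduct_nonpos {y : Fin k → ℝ} {δ : ℝ} (hδ : 0 ≤ δ) (ν : Fin k → ℝ)
    {v : Fin k → ℝ} (hv : v ∈ l2ball y δ) :
    (ν - ballProj y δ ν) ⬝ᵥ (v - ballProj y δ ν) ≤ 0 := by
  unfold ballProj
  split_ifs with h
  · rw [sub_self, zero_dotProduct]
  · have hpos : 0 < l2norm (ν - y) := hδ.trans_lt (not_le.1 h)
    have hratio : 0 ≤ 1 - δ / l2norm (ν - y) :=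
      sub_nonneg.2 ((div_le_one hpos).2 (not_le.1 h).le)
    have hcauchy : (ν - y) ⬝ᵥ (v - y) ≤ l2norm (ν - y) * δ :=
      (dotProduct_le_l2norm_mul_l2norm _ _).trans (mul_le_mul_of_nonneg_left hv hpos.le)
    have hsmul : ν - (y + (δ / l2norm (ν - y)) • (ν - y)) =
        (1 - δ / l2norm (ν - y)) • (ν - y) := by module
    rw [hsmul, ← sub_sub, smul_dotProduct, dotProduct_sub, dotProduct_smul, ← l2norm_sq,
      smul_eq_mul, smul_eq_mul]
    refine mul_nonpos_of_nonneg_of_nonpos hratio (sub_nonpos.2 (hcauchy.trans_eq ?_))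
    field_simp

theorem smul_sub_ballProj_mem_subdifferential {δ c : ℝ} (hδ : 0 ≤ δ) (hc : 0 ≤ c)
    (y ν : Fin k → ℝ) :
    c • (ν - ballProj y δ ν) ∈ subdifferential (indic (l2ball y δ)) (ballProj y δ ν) := by
  refine mem_subdifferential_indic.2 ⟨ballProj_mem hδ y ν, fun v hv => ?_⟩
  rw [smul_dotProduct]
  exact mul_nonpos_of_nonneg_of_nonpos hc (sub_ballProj_dotProduct_nonpos hδ ν hv)

theorem argminSet_ball (y : Fin k → ℝ) {δ : ℝ} (hδ : 0 ≤ δ) (ν : Fin k → ℝ) :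
    argminSet (fun u => ((1 / 2 * l2norm (u - ν) ^ 2 : ℝ) : EReal) + indic (l2ball y δ) u) =
      {ballProj y δ ν} := by
  simp only [add_comm _ (indic _ _)]
  exact argminSet_add_sq_sub_eq_singleton one_pos
    (smul_sub_ballProj_mem_subdifferential hδ zero_le_one y ν)

theorem max_zero_soft {τ : ℝ} (hτ : 0 ≤ τ) (a : ℝ) : max 0 (soft a τ) = max 0 (a - τ) := by
  unfold soft
  rcases lt_trichotomy a 0 with h | rfl | h
  · rw [Real.sign_of_neg h, neg_one_mul, max_eq_left (neg_nonpos.2 (le_max_right _ _)),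
      max_eq_left (by linarith)]
  · rw [Real.sign_zero, zero_mul, max_self, max_eq_left (by linarith)]
  · rw [Real.sign_of_pos h, abs_of_pos h, one_mul, max_comm (a - τ), ← max_assoc, max_self]

theorem nonnegSoft_mem (ν : Fin n → ℝ) (τ : ℝ) : nonnegSoft ν τ ∈ orthant n :=
  fun _ => le_max_left _ _

theorem mul_l1norm_nonnegSoft_add_le {τ : ℝ} (hτ : 0 ≤ τ) (ν : Fin n → ℝ) {v : Fin n → ℝ}
    (hv : v ∈ orthant n) :
    τ * l1norm (nonnegSoft ν τ) + (ν - nonnegSoft ν τ) ⬝ᵥ (v - nonnegSoft ν τ) ≤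
      τ * l1norm v := by
  rw [l1norm_eq_sum hv, l1norm_eq_sum (nonnegSoft_mem ν τ), dotProduct, Finset.mul_sum,
    Finset.mul_sum, ← Finset.sum_add_distrib]
  refine Finset.sum_le_sum fun i _ => ?_
  simp only [Pi.sub_apply, nonnegSoft, max_zero_soft hτ]
  rcases le_total 0 (ν i - τ) with h | h
  · rw [max_eq_right h]
    linarith
  · rw [max_eq_left h]
    linarith [mul_nonneg (sub_nonneg.2 (sub_nonpos.1 h)) (hv i)]

theorem smul_sub_nonnegSoft_mem_subdifferential {lam c : ℝ} (hlam : 0 ≤ lam) (hc : 0 < c)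
    (ν : Fin n → ℝ) :
    c • (ν - nonnegSoft ν (lam / c)) ∈
      subdifferential (fun u => ((lam * l1norm u : ℝ) : EReal) + indic (orthant n) u)
        (nonnegSoft ν (lam / c)) := by
  refine mem_subdifferential_coe_add_indic.2 ⟨nonnegSoft_mem _ _, fun v hv => ?_⟩
  have h := mul_le_mul_of_nonneg_left
    (mul_l1norm_nonnegSoft_add_le (div_nonneg hlam hc.le) ν hv) hc.le
  rwa [mul_add, ← mul_assoc, ← mul_assoc, mul_div_cancel₀ _ hc.ne', ← smul_eq_mul c,
    ← smul_dotProduct] at h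

theorem argminSet_nonnegSoft {τ : ℝ} (hτ : 0 ≤ τ) (ν : Fin n → ℝ) :
    argminSet (fun u => ((1 / 2 * l2norm (u - ν) ^ 2 + τ * l1norm u : ℝ) : EReal) +
      indic (orthant n) u) = {nonnegSoft ν τ} := by
  have h := smul_sub_nonnegSoft_mem_subdifferential hτ one_pos ν
  rw [div_one] at h
  rw [← argminSet_add_sq_sub_eq_singleton one_pos h]
  simp only [EReal.coe_add, add_assoc, add_comm ((1 / 2 * l2norm (_ - ν) ^ 2 : ℝ) : EReal)]

end Prox

section Splitting

variable {k n : ℕ}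

theorem csG_mulVec (A : Matrix (Fin k) (Fin n) ℝ) (x : Fin n → ℝ) :
    csG A *ᵥ x = Sum.elim (A *ᵥ x) x := by
  rw [csG, fromRows_mulVec, one_mulVec]

theorem transpose_csG_mulVec (A : Matrix (Fin k) (Fin n) ℝ) (v₁ : Fin k → ℝ) (v₂ : Fin n → ℝ) :
    (csG A)ᵀ *ᵥ Sum.elim v₁ v₂ = Aᵀ *ᵥ v₁ + v₂ := by
  rw [csG, transpose_fromRows, fromCols_mulVec_sumElim, transpose_one, one_mulVec]

theorem transpose_csG_mul_csG (A : Matrix (Fin k) (Fin n) ℝ) : (csG A)ᵀ * csG A = csB A := by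
  rw [csG, transpose_fromRows, fromCols_mul_fromRows, transpose_one, one_mul, csB]

theorem csG_mulVec_injective (A : Matrix (Fin k) (Fin n) ℝ) :
    Function.Injective (csG A).mulVec := fun x z h => by
  rw [csG_mulVec, csG_mulVec] at h
  exact (Sum.elim_eq_iff.1 h).2

theorem rank_csG (A : Matrix (Fin k) (Fin n) ℝ) : (csG A).rank = n := by
  rw [Matrix.rank, LinearMap.finrank_range_of_inj (csG_mulVec_injective A), Module.finrank_fin_fun]

theorem posDef_csB (A : Matrix (Fin k) (Fin n) ℝ) : (csB A).PosDef := by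
  rw [← transpose_csG_mul_csG, ← conjTranspose_eq_transpose_of_trivial]
  exact .conjTranspose_mul_self _ (csG_mulVec_injective A)

theorem one_dotProduct_inv_csB_pos (hn : 0 < n) (A : Matrix (Fin k) (Fin n) ℝ) :
    0 < (1 : Fin n → ℝ) ⬝ᵥ (csB A)⁻¹ *ᵥ 1 := by
  have : Nonempty (Fin n) := ⟨⟨0, hn⟩⟩
  simpa using (posDef_csB A).inv.dotProduct_mulVec_pos (one_ne_zero (α := Fin n → ℝ))

theorem csF1_eq_indic : csF1 (n := n) = indic {x | ∑ i, x i = 1} := rfl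

theorem isClosedProperConvex_csF1 (hn : 0 < n) : IsClosedProperConvex (csF1 (n := n)) := by
  have hconv : Convex ℝ {x : Fin n → ℝ | ∑ i, x i = 1} := by
    simp only [← one_dotProduct]
    exact convex_hyperplane (dotProductBilin ℝ ℝ 1).isLinear 1
  rw [csF1_eq_indic]
  exact isClosedProperConvex_indic hconv (isClosed_eq (by fun_prop) continuous_const)
    ⟨Pi.single ⟨0, hn⟩ 1, by simp⟩

/-- The effective domain of `csF2`. -/
def csDom (y : Fin k → ℝ) (δ : ℝ) : Set (Fin k ⊕ Fin n → ℝ) :=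
  (· ∘ Sum.inl) ⁻¹' l2ball y δ ∩ (· ∘ Sum.inr) ⁻¹' orthant n

theorem csF2_eq_coe_add_indic (y : Fin k → ℝ) (δ lam : ℝ) :
    csF2 y δ lam = fun u : Fin k ⊕ Fin n → ℝ =>
      ((lam * l1norm (u ∘ Sum.inr) : ℝ) : EReal) + indic (csDom y δ) u := by
  funext u
  rw [csDom, indic_inter, ← add_assoc, add_comm _ (indic (_ ⁻¹' l2ball y δ) u)]
  rfl

theorem convex_csDom (y : Fin k → ℝ) (δ : ℝ) : Convex ℝ (csDom (n := n) y δ) :=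
  ((convex_l2ball y δ).is_linear_preimage ⟨fun _ _ => rfl, fun _ _ => rfl⟩).inter
    ((convex_orthant n).is_linear_preimage ⟨fun _ _ => rfl, fun _ _ => rfl⟩)

theorem isClosed_csDom (y : Fin k → ℝ) (δ : ℝ) : IsClosed (csDom (n := n) y δ) :=
  ((isClosed_l2ball y δ).preimage (by fun_prop)).inter
    ((isClosed_orthant n).preimage (by fun_prop))

theorem convexOn_mul_l1norm_csDom (y : Fin k → ℝ) (δ lam : ℝ) :
    ConvexOn ℝ (csDom (n := n) y δ) fun u => lam * l1norm (u ∘ Sum.inr) := by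
  refine ⟨convex_csDom y δ, fun u hu v hv a b ha hb hab => le_of_eq ?_⟩
  have hsum : ∀ w ∈ csDom (n := n) y δ, l1norm (w ∘ Sum.inr) = ∑ i, w (Sum.inr i) :=
    fun w hw => l1norm_eq_sum hw.2
  simp only [hsum _ (convex_csDom y δ hu hv ha hb hab), hsum u hu, hsum v hv, Pi.add_apply,
    Pi.smul_apply, smul_eq_mul, Finset.sum_add_distrib, ← Finset.mul_sum]
  ring

theorem isClosedProperConvex_csF2 (y : Fin k → ℝ) {δ : ℝ} (hδ : 0 ≤ δ) (lam : ℝ) :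
    IsClosedProperConvex (csF2 (k := k) (n := n) y δ lam) := by
  rw [csF2_eq_coe_add_indic]
  have hcont : Continuous fun u : Fin k ⊕ Fin n → ℝ => lam * l1norm (u ∘ Sum.inr) := by
    unfold l1norm
    fun_prop
  exact isClosedProperConvex_coe_add_indic (convexOn_mul_l1norm_csDom y δ lam)
    (hcont.lowerSemicontinuous.lowerSemicontinuousOn _) (isClosed_csDom y δ)
    ⟨Sum.elim y 0, center_mem_l2ball y hδ, fun _ => le_rfl⟩

theorem l1norm_eq_one_of_mem_cbpdnFeasible {A : Matrix (Fin k) (Fin n) ℝ} {y : Fin k → ℝ}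
    {δ : ℝ} {x : Fin n → ℝ} (hx : x ∈ cbpdnFeasible A y δ) : l1norm x = 1 :=
  (l1norm_eq_sum hx.2.1).trans hx.2.2

theorem cbpdnSolutions_eq_feasible (A : Matrix (Fin k) (Fin n) ℝ) (y : Fin k → ℝ) (δ : ℝ) :
    cbpdnSolutions A y δ = cbpdnFeasible A y δ :=
  setOf_isMinOn_eq_of_forall_eq fun _ => l1norm_eq_one_of_mem_cbpdnFeasible

theorem cbpFeasible_eq (A : Matrix (Fin k) (Fin n) ℝ) (y : Fin k → ℝ) :
    cbpFeasible A y = cbpdnFeasible A y 0 := by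
  ext x
  simp only [cbpFeasible, cbpdnFeasible, Set.mem_ofPred_eq, (l2norm_nonneg _).ge_iff_eq',
    l2norm_eq_zero, sub_eq_zero]

theorem cbpSolutions_eq (A : Matrix (Fin k) (Fin n) ℝ) (y : Fin k → ℝ) :
    cbpSolutions A y = cbpdnSolutions A y 0 := by
  rw [cbpSolutions, cbpdnSolutions, cbpFeasible_eq]

theorem mem_cbpdnFeasible_iff {A : Matrix (Fin k) (Fin n) ℝ} {y : Fin k → ℝ} {δ : ℝ}
    {x : Fin n → ℝ} :
    x ∈ cbpdnFeasible A y δ ↔ ∑ i, x i = 1 ∧ csG A *ᵥ x ∈ csDom y δ := by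
  rw [csG_mulVec, and_comm]
  exact and_assoc.symm

theorem csF1_add_csF2_eq (A : Matrix (Fin k) (Fin n) ℝ) (y : Fin k → ℝ) (δ lam : ℝ)
    (x : Fin n → ℝ) :
    csF1 x + csF2 y δ lam (csG A *ᵥ x) =
      ((lam * l1norm x : ℝ) : EReal) + indic (cbpdnFeasible A y δ) x := by
  have hfeas : cbpdnFeasible A y δ = {x | ∑ i, x i = 1} ∩ (csG A).mulVec ⁻¹' csDom y δ :=
    Set.ext fun _ => mem_cbpdnFeasible_iff
  rw [hfeas, indic_inter, csF1_eq_indic, csF2_eq_coe_add_indic, add_left_comm, csG_mulVec,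
    Sum.elim_comp_inr, ← csG_mulVec]
  rfl

theorem argminSet_csF1_add_csF2 (A : Matrix (Fin k) (Fin n) ℝ) (y : Fin k → ℝ) (δ lam : ℝ) :
    argminSet (fun x => csF1 x + csF2 y δ lam (csG A *ᵥ x)) = cbpdnFeasible A y δ := by
  simp only [csF1_add_csF2_eq, argminSet_coe_add_indic]
  exact setOf_isMinOn_eq_of_forall_eq fun _ hx =>
    congrArg (lam * ·) (l1norm_eq_one_of_mem_cbpdnFeasible hx)

theorem smul_one_mem_subdifferential_csF1 {x : Fin n → ℝ} (hx : ∑ i, x i = 1) (c : ℝ) :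
    c • (1 : Fin n → ℝ) ∈ subdifferential csF1 x := by
  rw [csF1_eq_indic]
  refine mem_subdifferential_indic.2 ⟨hx, fun z hz => le_of_eq ?_⟩
  rw [smul_dotProduct, dotProduct_sub, one_dotProduct, one_dotProduct, hx, hz, sub_self, smul_zero]

theorem sumElim_mem_subdifferential_csF2 {y u₁ g₁ : Fin k → ℝ} {u₂ g₂ : Fin n → ℝ} {δ lam : ℝ}
    (h₁ : g₁ ∈ subdifferential (indic (l2ball y δ)) u₁)
    (h₂ : g₂ ∈ subdifferential (fun v => ((lam * l1norm v : ℝ) : EReal) + indic (orthant n) v) u₂) :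
    Sum.elim g₁ g₂ ∈ subdifferential (csF2 y δ lam) (Sum.elim u₁ u₂) := by
  have hcsF2 : csF2 y δ lam = fun u : Fin k ⊕ Fin n → ℝ => indic (l2ball y δ) (u ∘ Sum.inl) +
      (((lam * l1norm (u ∘ Sum.inr) : ℝ) : EReal) + indic (orthant n) (u ∘ Sum.inr)) :=
    funext fun u => add_assoc _ _ _
  rw [hcsF2]
  exact sumElim_mem_subdifferential h₁ h₂

theorem sum_csXUpdate (hn : 0 < n) (A : Matrix (Fin k) (Fin n) ℝ) (u₁ d₁ : Fin k → ℝ)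
    (u₂ d₂ : Fin n → ℝ) : ∑ i, csXUpdate A u₁ d₁ u₂ d₂ i = 1 := by
  rw [← one_dotProduct]
  simp only [csXUpdate, csC, dotProduct_sub, dotProduct_smul, smul_eq_mul]
  rw [inv_mul_cancel₀ (one_dotProduct_inv_csB_pos hn A).ne', mul_one, sub_sub_cancel]

theorem exists_csB_mulVec_csXUpdate_eq (A : Matrix (Fin k) (Fin n) ℝ) (u₁ d₁ : Fin k → ℝ)
    (u₂ d₂ : Fin n → ℝ) :
    ∃ c : ℝ, csB A *ᵥ csXUpdate A u₁ d₁ u₂ d₂ = Aᵀ *ᵥ (u₁ + d₁) + (u₂ + d₂) - c • 1 := by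
  have hdet : IsUnit (csB A).det := (isUnit_iff_isUnit_det _).1 (posDef_csB A).isUnit
  simp only [csXUpdate, csC, mulVec_sub, mulVec_smul, mulVec_mulVec, mul_nonsing_inv _ hdet,
    one_mulVec, smul_smul]
  exact ⟨_, rfl⟩

theorem argminSet_admmObjX (hn : 0 < n) (A : Matrix (Fin k) (Fin n) ℝ) {μ : ℝ} (hμ : 0 < μ)
    (u₁ d₁ : Fin k → ℝ) (u₂ d₂ : Fin n → ℝ) :
    argminSet (admmObjX csF1 (csG A) μ (Sum.elim u₁ u₂) (Sum.elim d₁ d₂)) =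
      {csXUpdate A u₁ d₁ u₂ d₂} := by
  rw [admmObjX_eq]
  refine argminSet_add_sq_eq_singleton (csG_mulVec_injective A) hμ ?_
  obtain ⟨c, hc⟩ := exists_csB_mulVec_csXUpdate_eq A u₁ d₁ u₂ d₂
  rw [mulVec_sub, mulVec_mulVec, transpose_csG_mul_csG, hc, ← Sum.elim_add_add,
    transpose_csG_mulVec, sub_sub_cancel, smul_smul]
  exact smul_one_mem_subdifferential_csF1 (sum_csXUpdate hn A u₁ d₁ u₂ d₂) _

theorem argminSet_admmObjU (A : Matrix (Fin k) (Fin n) ℝ) (y : Fin k → ℝ) {δ lam μ : ℝ}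
    (hδ : 0 ≤ δ) (hlam : 0 ≤ lam) (hμ : 0 < μ) (x : Fin n → ℝ) (d₁ : Fin k → ℝ)
    (d₂ : Fin n → ℝ) :
    argminSet (admmObjU (csF2 y δ lam) (csG A) μ x (Sum.elim d₁ d₂)) =
      {Sum.elim (ballProj y δ (A *ᵥ x - d₁)) (nonnegSoft (x - d₂) (lam / μ))} := by
  rw [admmObjU_eq]
  refine argminSet_add_sq_sub_eq_singleton hμ ?_
  rw [csG_mulVec, ← Sum.elim_sub_sub, ← Sum.elim_sub_sub]
  convert sumElim_mem_subdifferential_csF2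
    (smul_sub_ballProj_mem_subdifferential hδ hμ.le y (A *ᵥ x - d₁))
    (smul_sub_nonnegSoft_mem_subdifferential hlam hμ (x - d₂)) using 1
  exact Sum.comp_elim (fun a : ℝ => μ • a) _ _

theorem isCSUnSAL_iff_isADMM (hn : 0 < n) (A : Matrix (Fin k) (Fin n) ℝ) (y : Fin k → ℝ)
    {δ lam μ : ℝ} (hδ : 0 ≤ δ) (hlam : 0 ≤ lam) (hμ : 0 < μ) (x : ℕ → Fin n → ℝ)
    (u₁ d₁ : ℕ → Fin k → ℝ) (u₂ d₂ : ℕ → Fin n → ℝ) :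
    IsCSUnSAL A y δ lam μ x u₁ d₁ u₂ d₂ ↔
      IsADMM csF1 (csF2 y δ lam) (csG A) μ x
        (fun j => Sum.elim (u₁ j) (u₂ j)) (fun j => Sum.elim (d₁ j) (d₂ j)) := by
  have hx (j : ℕ) := argminSet_admmObjX hn A hμ (u₁ j) (d₁ j) (u₂ j) (d₂ j)
  have hu (j : ℕ) := argminSet_admmObjU A y hδ hlam hμ (x (j + 1)) (d₁ j) (d₂ j)
  have hd (j : ℕ) : Sum.elim (d₁ (j + 1)) (d₂ (j + 1)) = Sum.elim (d₁ j) (d₂ j) -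
        (csG A *ᵥ x (j + 1) - Sum.elim (u₁ (j + 1)) (u₂ (j + 1))) ↔
      d₁ (j + 1) = d₁ j - (A *ᵥ x (j + 1) - u₁ (j + 1)) ∧
        d₂ (j + 1) = d₂ j - (x (j + 1) - u₂ (j + 1)) := by
    rw [csG_mulVec, ← Sum.elim_sub_sub, ← Sum.elim_sub_sub, Sum.elim_eq_iff]
  constructor
  · intro h
    exact ⟨fun j => (hx j).ge (h.x_step j),
      fun j => (hu j).ge (Sum.elim_eq_iff.2 ⟨h.u₁_step j, h.u₂_step j⟩),
      fun j => (hd j).2 ⟨h.d₁_step j, h.d₂_step j⟩⟩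
  · intro h
    have hu' (j : ℕ) := Sum.elim_eq_iff.1 ((hu j).le (h.u_step j))
    have hd' (j : ℕ) := (hd j).1 (h.d_step j)
    exact ⟨fun j => (hx j).le (h.x_step j), fun j => (hu' j).1, fun j => (hu' j).2,
      fun j => (hd' j).1, fun j => (hd' j).2⟩

theorem isKKTPair_of_mem_cbpdnFeasible {A : Matrix (Fin k) (Fin n) ℝ} {y : Fin k → ℝ}
    {δ : ℝ} {x : Fin n → ℝ} (hx : x ∈ cbpdnFeasible A y δ) (lam : ℝ) :
    IsKKTPair csF1 (csF2 y δ lam) (csG A) x (Sum.elim 0 (-lam • 1)) where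
  fst_mem := by
    rw [transpose_csG_mulVec, mulVec_zero, zero_add]
    exact smul_one_mem_subdifferential_csF1 hx.2.2 (-lam)
  snd_mem := by
    rw [csG_mulVec, ← Sum.elim_neg_neg, neg_zero, neg_smul, neg_neg]
    refine sumElim_mem_subdifferential_csF2
      (mem_subdifferential_indic.2 ⟨hx.1, fun _ _ => (zero_dotProduct _).le⟩)
      (mem_subdifferential_coe_add_indic.2 ⟨hx.2.1, fun z hz => le_of_eq ?_⟩)
    rw [l1norm_eq_sum hx.2.1, l1norm_eq_sum hz, smul_dotProduct, one_dotProduct, smul_eq_mul,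
      ← mul_add, ← Finset.sum_add_distrib]
    simp only [Pi.sub_apply, add_sub_cancel]

theorem IsCSUnSAL.exists_tendsto (hn : 0 < n) {A : Matrix (Fin k) (Fin n) ℝ} {y : Fin k → ℝ}
    {δ lam μ : ℝ} (hδ : 0 ≤ δ) (hlam : 0 ≤ lam) (hμ : 0 < μ) {x : ℕ → Fin n → ℝ}
    {u₁ d₁ : ℕ → Fin k → ℝ} {u₂ d₂ : ℕ → Fin n → ℝ} (h : IsCSUnSAL A y δ lam μ x u₁ d₁ u₂ d₂)
    (hne : (cbpdnSolutions A y δ).Nonempty) :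
    ∃ xs ∈ cbpdnSolutions A y δ, Tendsto x atTop (𝓝 xs) := by
  rw [cbpdnSolutions_eq_feasible] at hne ⊢
  obtain ⟨z, hz⟩ := hne
  obtain ⟨xs, g, hKKT, hlim⟩ :=
    ((isCSUnSAL_iff_isADMM hn A y hδ hlam hμ x u₁ d₁ u₂ d₂).1 h).exists_tendsto hμ
      (isClosedProperConvex_csF1 hn) (isClosedProperConvex_csF2 y hδ lam)
      (csG_mulVec_injective A) ⟨z, _, isKKTPair_of_mem_cbpdnFeasible hz lam⟩
  exact ⟨xs, argminSet_csF1_add_csF2 A y δ lam ▸ hKKT.mem_argminSet, hlim⟩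

end Splitting

theorem mainTheorem2 {k n : ℕ} (hn : 0 < n) (A : Matrix (Fin k) (Fin n) ℝ) (y : Fin k → ℝ)
    (δ lam μ : ℝ) (hδ : 0 ≤ δ) (hlam : 0 ≤ lam) (hμ : 0 < μ) :
    -- CBPDN is the unconstrained problem `min f₁(x) + f₂(G x)`; CBP is the case `δ = 0`
    cbpdnSolutions A y δ = argminSet (fun x => csF1 x + csF2 y δ lam (csG A *ᵥ x)) ∧
    cbpSolutions A y = cbpdnSolutions A y 0 ∧
    -- `f₁`, `f₂` are closed, proper, convex and `G` has full column rank
    IsClosedProperConvex (csF1 (n := n)) ∧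
    IsClosedProperConvex (csF2 (k := k) (n := n) y δ lam) ∧
    (csG A).rank = n ∧
    -- the closed-form `x`-update is well defined and solves the equality-constrained
    -- quadratic problem
    IsUnit (csB A) ∧ (1 : Fin n → ℝ) ⬝ᵥ (csB A)⁻¹ *ᵥ 1 ≠ 0 ∧
    (∀ (u₁ d₁ : Fin k → ℝ) (u₂ d₂ : Fin n → ℝ),
      argminSet (admmObjX csF1 (csG A) μ (Sum.elim u₁ u₂) (Sum.elim d₁ d₂)) =
        {csXUpdate A u₁ d₁ u₂ d₂}) ∧
    -- the `u`-updates: projection onto the ball and nonnegative soft thresholding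
    (∀ ν : Fin k → ℝ,
      argminSet (fun u => ((1 / 2 * l2norm (u - ν) ^ 2 : ℝ) : EReal) + indic (l2ball y δ) u) =
        {ballProj y δ ν}) ∧
    (∀ ν : Fin n → ℝ,
      argminSet (fun u => ((1 / 2 * l2norm (u - ν) ^ 2 + lam / μ * l1norm u : ℝ) : EReal) +
        indic (orthant n) u) = {nonnegSoft ν (lam / μ)}) ∧
    (∀ (x : Fin n → ℝ) (d₁ : Fin k → ℝ) (d₂ : Fin n → ℝ),
      argminSet (admmObjU (csF2 y δ lam) (csG A) μ x (Sum.elim d₁ d₂)) =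
        {Sum.elim (ballProj y δ (A *ᵥ x - d₁)) (nonnegSoft (x - d₂) (lam / μ))}) ∧
    -- CBPDN has a solution as soon as it is feasible
    ((cbpdnFeasible A y δ).Nonempty → (cbpdnSolutions A y δ).Nonempty) ∧
    ∀ (x : ℕ → Fin n → ℝ) (u₁ d₁ : ℕ → Fin k → ℝ) (u₂ d₂ : ℕ → Fin n → ℝ),
      -- C-SUnSAL is ADMM for this splitting
      (IsCSUnSAL A y δ lam μ x u₁ d₁ u₂ d₂ ↔
        IsADMM csF1 (csF2 y δ lam) (csG A) μ x
          (fun j => Sum.elim (u₁ j) (u₂ j)) (fun j => Sum.elim (d₁ j) (d₂ j))) ∧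
      -- convergence of C-SUnSAL, for CBPDN and for CBP
      (IsCSUnSAL A y δ lam μ x u₁ d₁ u₂ d₂ →
        ((cbpdnSolutions A y δ).Nonempty →
          ∃ xs ∈ cbpdnSolutions A y δ, Tendsto x atTop (𝓝 xs)) ∧
        (δ = 0 → (cbpSolutions A y).Nonempty →
          ∃ xs ∈ cbpSolutions A y, Tendsto x atTop (𝓝 xs))) := by
  refine ⟨?_, cbpSolutions_eq A y, isClosedProperConvex_csF1 hn,
    isClosedProperConvex_csF2 y hδ lam, rank_csG A, (posDef_csB A).isUnit,
    (one_dotProduct_inv_csB_pos hn A).ne', argminSet_admmObjX hn A hμ, argminSet_ball y hδ,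
    argminSet_nonnegSoft (div_nonneg hlam hμ.le), argminSet_admmObjU A y hδ hlam hμ, ?_,
    fun x u₁ d₁ u₂ d₂ => ⟨isCSUnSAL_iff_isADMM hn A y hδ hlam hμ x u₁ d₁ u₂ d₂,
      fun h => ⟨h.exists_tendsto hn hδ hlam hμ, ?_⟩⟩⟩
  · rw [cbpdnSolutions_eq_feasible, argminSet_csF1_add_csF2]
  · rw [cbpdnSolutions_eq_feasible]
    exact id
  · rintro rfl
    rw [cbpSolutions_eq]
    exact h.exists_tendsto hn hδ hlam hμ
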